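/- For an integer $d\ge 0$, a finite graph $G$ is called $d$-degenerate if its vertices admit a linear ordering $v_1,\ldots,v_n$ such that every $v_i$ has at most $d$ neighbors among $v_1,\ldots,v_{i-1}$. For every integer $d\ge 0$ there exists a triangle-free $d$-degenerate graph with chromatic number $d+1$; let $f(d)$ be the minimum number of vertices of such a graph. Then $$e^{\Omega(d)}\le f(d)\le e^{O(d^2\log d)},$$ that is, there are absolute constants $c,C>0$ such that $f(d)\ge e^{cd}$ for all integers $d\ge 1$ and $f(d)\le e^{Cd^2\log d}$ for all integers $d\ge 2$. -/

import Mathlib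

/-- A finite graph `G` is `d`-degenerate if its vertices can be linearly ordered so that every vertex
has at most `d` neighbours that precede it in the ordering. -/
def SimpleGraph.IsDegenerate {V : Type*} [Finite V] (G : SimpleGraph V) (d : ℕ) : Prop :=
  ∃ _ : LinearOrder V, ∀ v : V, {u : V | G.Adj u v ∧ u < v}.ncard ≤ d

/-- The set of all orders `n` of triangle-free `d`-degenerate graphs of chromatic number `d + 1`
(up to isomorphism, the vertex set is `Fin n`). -/
def criticalOrders (d : ℕ) : Set ℕ :=
  {n : ℕ | ∃ G : SimpleGraph (Fin n),
    G.CliqueFree 3 ∧ G.IsDegenerate d ∧ G.chromaticNumber = ((d + 1 : ℕ) : ℕ∞)}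

/-- `minOrder d` is the minimum order of a triangle-free `d`-degenerate graph of chromatic number
`d + 1`. -/
noncomputable def minOrder (d : ℕ) : ℕ := sInf (criticalOrders d)

/-! Lower bound. A triangle-free `d`-degenerate graph on fewer than `exp (lam * (d / 2))` vertices
is `d`-colourable. Scan the vertices in the degeneracy order and build a random independent set. The
weight of `v` starts at `p`, drops to 0 when a preceding neighbour is chosen, and is otherwise
rescaled by `(1 - selProb)⁻¹`, so it is a martingale. Triangle-freeness makes the weights of `v` and
of its preceding neighbours uncorrelated, so truncation at `q` costs little and every vertex is
chosen with probability at least `6 / d` (`le_expSel_selProb`). A set of at least half of `d`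
vertices then loses 3 members on average. An exponential potential shows that after `d / 2` such
colour classes every vertex has fewer than `d - d / 2` uncoloured preceding neighbours, and the rest
is coloured greedily (`exists_coloring_of_expSel`).

Upper bound. In a tree of blocks of at least `d * d` vertices, each block is joined to one vertex in
each ancestor block, these being pairwise nonadjacent. In any colouring with `d` colours one
descends the tree along blocks whose popular colours are all distinct, and obtains `d + 1` colours
(`exists_distinct_block_colors`). -/

/-! ### The random independent set and its moments -/

/-- The probability with which the vertex `v` joins the random independent set, when `S` is the set of
vertices chosen so far and `N u` is the set of neighbours of `u` that precede it. -/
noncomputable def selProb (N : ℕ → Finset ℕ) (p q : ℝ) (v : ℕ) (S : Finset ℕ) : ℝ :=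
  if p * ∏ u ∈ ((N v).filter (· < v)).attach,
      (if u.1 ∈ S then 0 else (1 - selProb N p q u.1 S)⁻¹) ≤ q then
    p * ∏ u ∈ ((N v).filter (· < v)).attach,
      (if u.1 ∈ S then 0 else (1 - selProb N p q u.1 S)⁻¹)
  else 0
termination_by v
decreasing_by all_goals exact (Finset.mem_filter.1 u.2).2

/-- The weight of the vertex `v` once the vertices below `m` have been processed. -/
noncomputable def weightAt (N : ℕ → Finset ℕ) (p q : ℝ) (v m : ℕ) (S : Finset ℕ) : ℝ :=
  p * ∏ u ∈ (N v).filter (· < m), (if u ∈ S then 0 else (1 - selProb N p q u S)⁻¹)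

/-- The expectation of `f` at the random independent set chosen among the first `n` vertices. -/
noncomputable def expSel (N : ℕ → Finset ℕ) (p q : ℝ) : ℕ → (Finset ℕ → ℝ) → ℝ
  | 0, f => f ∅
  | n + 1, f => expSel N p q n fun S =>
      selProb N p q n S * f (insert n S) + (1 - selProb N p q n S) * f S

section Selection

variable {N : ℕ → Finset ℕ} {p q : ℝ}

theorem selProb_eq (v : ℕ) (S : Finset ℕ) :
    selProb N p q v S = if weightAt N p q v v S ≤ q then weightAt N p q v v S else 0 := by
  have h : p * ∏ u ∈ ((N v).filter (· < v)).attach,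
      (if u.1 ∈ S then 0 else (1 - selProb N p q u.1 S)⁻¹) = weightAt N p q v v S := by
    rw [weightAt, Finset.prod_attach ((N v).filter (· < v))
      (fun u => if u ∈ S then 0 else (1 - selProb N p q u S)⁻¹)]
  rw [selProb, h]

theorem selProb_le (hq : 0 ≤ q) (v : ℕ) (S : Finset ℕ) : selProb N p q v S ≤ q := by
  rw [selProb_eq]; split_ifs <;> assumption

theorem weightFactor_nonneg (hq : 0 ≤ q) (hq' : q ≤ 1 / 2) (u : ℕ) (S : Finset ℕ) :
    0 ≤ (if u ∈ S then 0 else (1 - selProb N p q u S)⁻¹) := by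
  have := selProb_le (N := N) (p := p) hq u S
  split_ifs
  · exact le_rfl
  · exact inv_nonneg.2 (by linarith)

theorem weightAt_nonneg (hp : 0 ≤ p) (hq : 0 ≤ q) (hq' : q ≤ 1 / 2) (v m : ℕ) (S : Finset ℕ) :
    0 ≤ weightAt N p q v m S :=
  mul_nonneg hp (Finset.prod_nonneg fun u _ => weightFactor_nonneg hq hq' u S)

theorem selProb_nonneg (hp : 0 ≤ p) (hq : 0 ≤ q) (hq' : q ≤ 1 / 2) (v : ℕ) (S : Finset ℕ) :
    0 ≤ selProb N p q v S := by
  rw [selProb_eq]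
  split_ifs
  · exact weightAt_nonneg hp hq hq' v v S
  · exact le_rfl

theorem selProb_le_weightAt (hp : 0 ≤ p) (hq : 0 ≤ q) (hq' : q ≤ 1 / 2) (v : ℕ) (S : Finset ℕ) :
    selProb N p q v S ≤ weightAt N p q v v S := by
  rw [selProb_eq]
  split_ifs
  · exact le_rfl
  · exact weightAt_nonneg hp hq hq' v v S

theorem selProb_insert {v m : ℕ} (hvm : v ≤ m) (S : Finset ℕ) :
    selProb N p q v (insert m S) = selProb N p q v S := by
  induction v using Nat.strong_induction_on with
  | _ v ih =>
    have h : weightAt N p q v v (insert m S) = weightAt N p q v v S := by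
      unfold weightAt
      congr 1
      refine Finset.prod_congr rfl fun u hu => ?_
      have huv := (Finset.mem_filter.1 hu).2
      rw [ih u huv (huv.le.trans hvm)]
      have : u ≠ m := (huv.trans_le hvm).ne
      simp [this]
    rw [selProb_eq, selProb_eq, h]

theorem weightAt_insert {m k : ℕ} (hmk : m ≤ k) (v : ℕ) (S : Finset ℕ) :
    weightAt N p q v m (insert k S) = weightAt N p q v m S := by
  unfold weightAt
  congr 1
  refine Finset.prod_congr rfl fun u hu => ?_
  have hum := (Finset.mem_filter.1 hu).2
  have : u ≠ k := (hum.trans_le hmk).ne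
  rw [selProb_insert (hum.le.trans hmk)]
  simp [this]

theorem weightAt_succ_of_notMem {v m : ℕ} (h : m ∉ N v) (S : Finset ℕ) :
    weightAt N p q v (m + 1) S = weightAt N p q v m S := by
  unfold weightAt
  congr 2
  ext u
  simp only [Finset.mem_filter, and_congr_right_iff]
  intro hu
  have : u ≠ m := fun e => h (e ▸ hu)
  omega

theorem weightAt_succ_of_mem {v m : ℕ} (h : m ∈ N v) (S : Finset ℕ) :
    weightAt N p q v (m + 1) S =
      (if m ∈ S then 0 else (1 - selProb N p q m S)⁻¹) * weightAt N p q v m S := by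
  have h1 : (N v).filter (· < m + 1) = insert m ((N v).filter (· < m)) := by
    ext u
    simp only [Finset.mem_filter, Finset.mem_insert, Nat.lt_succ_iff_lt_or_eq]
    constructor
    · rintro ⟨a, b | b⟩ <;> tauto
    · rintro (rfl | ⟨a, b⟩) <;> tauto
  unfold weightAt
  rw [h1, Finset.prod_insert (by simp)]
  ring

theorem weightAt_eq_of_le {u v : ℕ} (hN : ∀ w ∈ N u, w < u) (huv : u ≤ v) (S : Finset ℕ) :
    weightAt N p q u v S = weightAt N p q u u S := by
  unfold weightAt
  congr 2
  ext w
  simp only [Finset.mem_filter, and_congr_right_iff]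
  intro hw
  have := hN w hw
  omega

/-- A chosen preceding neighbour makes the weight vanish, so only independent sets carry mass. This
is what lets each random set serve as a colour class. -/
theorem expSel_mono (hp : 0 ≤ p) (hq : 0 ≤ q) (hq' : q ≤ 1 / 2) (hN : ∀ v, ∀ u ∈ N v, u < v)
    {n : ℕ} {f g : Finset ℕ → ℝ}
    (h : ∀ S ⊆ Finset.range n, (∀ v ∈ S, ∀ u ∈ S, u ∉ N v) → f S ≤ g S) :
    expSel N p q n f ≤ expSel N p q n g := by
  induction n generalizing f g with
  | zero => exact h ∅ (by simp) (by simp)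
  | succ n ih =>
    refine ih fun S hS hind => ?_
    have h0 := selProb_nonneg (N := N) hp hq hq' n S
    have h1 := selProb_le (N := N) (p := p) hq n S
    have hS' : S ⊆ Finset.range (n + 1) :=
      hS.trans (Finset.range_subset_range.2 n.le_succ)
    refine add_le_add ?_ (mul_le_mul_of_nonneg_left (h S hS' hind) (by linarith))
    by_cases hd : ∃ u ∈ S, u ∈ N n
    · obtain ⟨u, huS, hu⟩ := hd
      have hw : weightAt N p q n n S = 0 := by
        unfold weightAt
        rw [Finset.prod_eq_zero (i := u) (by simp [hu, hN n u hu]) (by simp [huS]), mul_zero]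
      rw [selProb_eq, hw]
      simp
    · push Not at hd
      refine mul_le_mul_of_nonneg_left (h _ ?_ ?_) h0
      · rw [Finset.range_add_one]
        exact Finset.insert_subset_insert _ hS
      · intro v hv u hu huv
        have hlt := hN v u huv
        rcases Finset.mem_insert.1 hv with rfl | hv
        · rcases Finset.mem_insert.1 hu with rfl | hu
          · exact lt_irrefl _ hlt
          · exact hd u hu huv
        · have := Finset.mem_range.1 (hS hv)
          rcases Finset.mem_insert.1 hu with rfl | hu
          · omega
          · exact hind v hv u hu huv

theorem expSel_congr {n : ℕ} {f g : Finset ℕ → ℝ} (h : ∀ S ⊆ Finset.range n, f S = g S) :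
    expSel N p q n f = expSel N p q n g := by
  induction n generalizing f g with
  | zero => exact h ∅ (by simp)
  | succ n ih =>
    refine ih fun S hS => ?_
    rw [h S (hS.trans (Finset.range_subset_range.2 n.le_succ)), h (insert n S)]
    rw [Finset.range_add_one]
    exact Finset.insert_subset_insert _ hS

theorem expSel_const (n : ℕ) (c : ℝ) : expSel N p q n (fun _ => c) = c := by
  induction n with
  | zero => rfl
  | succ n ih =>
    rw [expSel]
    convert ih using 3
    ring

theorem expSel_add (n : ℕ) (f g : Finset ℕ → ℝ) :
    expSel N p q n (fun S => f S + g S) = expSel N p q n f + expSel N p q n g := by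
  induction n generalizing f g with
  | zero => rfl
  | succ n ih =>
    simp only [expSel, ← ih]
    congr 1
    ext S
    ring

theorem expSel_mul (n : ℕ) (c : ℝ) (f : Finset ℕ → ℝ) :
    expSel N p q n (fun S => c * f S) = c * expSel N p q n f := by
  induction n generalizing f with
  | zero => rfl
  | succ n ih =>
    simp only [expSel, ← ih]
    congr 1
    ext S
    ring

theorem expSel_sum {ι : Type*} (n : ℕ) (s : Finset ι) (f : ι → Finset ℕ → ℝ) :
    expSel N p q n (fun S => ∑ i ∈ s, f i S) = ∑ i ∈ s, expSel N p q n (f i) := by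
  classical
  induction s using Finset.induction_on with
  | empty => simpa using expSel_const n 0
  | insert i s hi ih => simp only [Finset.sum_insert hi, expSel_add, ih]

/-- Martingale property: when a neighbour `m` is processed, the weight is multiplied by 0 with
probability `selProb` and by `(1 - selProb)⁻¹` otherwise. -/
theorem expSel_weightAt (hq : 0 ≤ q) (hq' : q ≤ 1 / 2) (v m : ℕ) :
    expSel N p q m (weightAt N p q v m) = p := by
  induction m with
  | zero => simp [expSel, weightAt]
  | succ m ih =>
    rw [expSel]
    refine (expSel_congr fun S hS => ?_).trans ih
    have hm : m ∉ S := fun h => by simpa using hS h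
    have h1 := selProb_le (N := N) (p := p) hq m S
    have h2 : 1 - selProb N p q m S ≠ 0 := by linarith
    by_cases hv : m ∈ N v
    · rw [weightAt_succ_of_mem hv, weightAt_succ_of_mem hv]
      simp [hm, h2]
    · rw [weightAt_succ_of_notMem hv, weightAt_succ_of_notMem hv, weightAt_insert le_rfl]
      ring

/-- With disjoint neighbourhoods each step changes at most one of the two weights, so the product is
again a martingale. -/
theorem expSel_weightAt_mul_weightAt (hq : 0 ≤ q) (hq' : q ≤ 1 / 2) {u v : ℕ}
    (huv : ∀ w ∈ N v, w ∉ N u) (m : ℕ) :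
    expSel N p q m (fun S => weightAt N p q v m S * weightAt N p q u m S) = p * p := by
  induction m with
  | zero => simp [expSel, weightAt]
  | succ m ih =>
    rw [expSel]
    refine (expSel_congr fun S hS => ?_).trans ih
    have hm : m ∉ S := fun h => by simpa using hS h
    have h1 := selProb_le (N := N) (p := p) hq m S
    have h2 : 1 - selProb N p q m S ≠ 0 := by linarith
    by_cases hv : m ∈ N v
    · have hu := huv m hv
      rw [weightAt_succ_of_mem hv, weightAt_succ_of_mem hv, weightAt_succ_of_notMem hu,
        weightAt_succ_of_notMem hu]
      simp only [Finset.mem_insert, true_or, if_true, hm, if_false]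
      field_simp
      ring
    · rw [weightAt_succ_of_notMem hv, weightAt_succ_of_notMem hv, weightAt_insert le_rfl]
      by_cases hu : m ∈ N u
      · rw [weightAt_succ_of_mem hu, weightAt_succ_of_mem hu]
        simp only [Finset.mem_insert, true_or, if_true, hm, if_false]
        field_simp
        ring
      · rw [weightAt_succ_of_notMem hu, weightAt_succ_of_notMem hu, weightAt_insert le_rfl]
        ring

theorem inv_one_sub_le_exp {x : ℝ} (h0 : 0 ≤ x) (h1 : x ≤ 1 / 2) :
    (1 - x)⁻¹ ≤ Real.exp (2 * x) := by
  have h2 : 0 < 1 - x := by linarith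
  rw [inv_le_iff_one_le_mul₀ h2]
  nlinarith [Real.add_one_le_exp (2 * x)]

theorem weightAt_le_exp (hp : 0 ≤ p) (hq : 0 ≤ q) (hq' : q ≤ 1 / 2) (hN : ∀ v, ∀ u ∈ N v, u < v)
    (v : ℕ) (S : Finset ℕ) :
    weightAt N p q v v S ≤ p * Real.exp (2 * ∑ u ∈ N v, selProb N p q u S) := by
  have hf : (N v).filter (· < v) = N v := Finset.filter_true_of_mem (hN v)
  rw [weightAt, hf, Finset.mul_sum, Real.exp_sum]
  refine mul_le_mul_of_nonneg_left ?_ hp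
  refine Finset.prod_le_prod (fun u _ => weightFactor_nonneg hq hq' u S) fun u _ => ?_
  have h0 := selProb_nonneg (N := N) hp hq hq' u S
  have h1 := selProb_le (N := N) (p := p) hq u S
  split_ifs
  · exact (Real.exp_pos _).le
  · exact inv_one_sub_le_exp h0 (h1.trans hq')

/-- Truncation loses only the part of the weight above `q`. There the preceding neighbours have
total selection probability above `L / 2`, so by a Markov-type bound the loss is at most `2 / L`
times the sum of the `d` or fewer products of weights, each of mean `p * p`. -/
theorem le_expSel_selProb (hp : 0 < p) (hq : 0 ≤ q) (hq' : q ≤ 1 / 2)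
    (hN : ∀ v, ∀ u ∈ N v, u < v) (htri : ∀ v, ∀ u ∈ N v, ∀ w ∈ N v, w ∉ N u)
    {L : ℝ} (hL : 0 < L) (hpq : p * Real.exp L ≤ q) {d : ℕ} (hd : ∀ v, (N v).card ≤ d) (v : ℕ) :
    p - 2 / L * (d * (p * p)) ≤ expSel N p q v (selProb N p q v) := by
  have key : ∀ S, weightAt N p q v v S + (-(2 / L)) *
      ∑ u ∈ N v, weightAt N p q v v S * weightAt N p q u v S ≤ selProb N p q v S := by
    intro S
    have hw := weightAt_nonneg (N := N) hp.le hq hq' v v S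
    have hsum : ∑ u ∈ N v, selProb N p q u S ≤ ∑ u ∈ N v, weightAt N p q u v S :=
      Finset.sum_le_sum fun u hu => by
        rw [weightAt_eq_of_le (hN u) (hN v u hu).le]
        exact selProb_le_weightAt hp.le hq hq' u S
    have h0 : 0 ≤ ∑ u ∈ N v, selProb N p q u S :=
      Finset.sum_nonneg fun u _ => selProb_nonneg hp.le hq hq' u S
    rw [← Finset.mul_sum]
    rw [selProb_eq]
    split_ifs with hle
    · have : 0 ≤ 2 / L * (weightAt N p q v v S * ∑ u ∈ N v, weightAt N p q u v S) := by
        have := h0.trans hsum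
        positivity
      linarith
    · have h1 := weightAt_le_exp hp.le hq hq' hN v S
      have h2 : Real.exp L < Real.exp (2 * ∑ u ∈ N v, selProb N p q u S) := by
        refine lt_of_mul_lt_mul_left (hpq.trans_lt ((not_le.1 hle).trans_le h1)) hp.le
      have h3 := Real.exp_lt_exp.1 h2
      have h4 : 1 ≤ 2 / L * ∑ u ∈ N v, weightAt N p q u v S := by
        rw [div_mul_eq_mul_div, le_div_iff₀ hL]
        linarith
      nlinarith
  refine le_trans ?_ (expSel_mono hp.le hq hq' hN fun S _ _ => key S)
  rw [expSel_add, expSel_mul, expSel_sum, expSel_weightAt hq hq',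
    Finset.sum_congr rfl fun u hu => expSel_weightAt_mul_weightAt hq hq' (htri v u hu) v,
    Finset.sum_const, nsmul_eq_mul]
  have h1 : ((N v).card : ℝ) * (p * p) ≤ d * (p * p) :=
    mul_le_mul_of_nonneg_right (by exact_mod_cast hd v) (by positivity)
  have h2 := mul_le_mul_of_nonneg_left h1 (by positivity : 0 ≤ 2 / L)
  linarith

theorem card_inter_range_succ_of_mem {T : Finset ℕ} {m : ℕ} (h : m ∈ T) :
    (T ∩ Finset.range (m + 1)).card = (T ∩ Finset.range m).card + 1 := by
  rw [Finset.range_add_one, Finset.inter_insert_of_mem h, Finset.card_insert_of_notMem (by simp)]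

theorem card_inter_range_succ_of_notMem {T : Finset ℕ} {m : ℕ} (h : m ∉ T) :
    (T ∩ Finset.range (m + 1)).card = (T ∩ Finset.range m).card := by
  rw [Finset.range_add_one, Finset.inter_insert_of_notMem h]

theorem expSel_succ_card_inter_of_mem {T : Finset ℕ} {m : ℕ} (h : m ∈ T) (F : ℝ → ℝ) :
    expSel N p q (m + 1) (fun S => F (T ∩ S).card) = expSel N p q m (fun S =>
      selProb N p q m S * F ((T ∩ S).card + 1) + (1 - selProb N p q m S) * F (T ∩ S).card) := by
  rw [expSel]
  refine expSel_congr fun S hS => ?_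
  have hm : m ∉ S := fun h => by simpa using hS h
  rw [Finset.inter_insert_of_mem h, Finset.card_insert_of_notMem (by simp [hm])]
  push_cast
  rfl

theorem expSel_succ_card_inter_of_notMem {T : Finset ℕ} {m : ℕ} (h : m ∉ T) (F : ℝ → ℝ) :
    expSel N p q (m + 1) (fun S => F (T ∩ S).card) = expSel N p q m (fun S => F (T ∩ S).card) := by
  rw [expSel]
  refine expSel_congr fun S hS => ?_
  rw [Finset.inter_insert_of_notMem h]
  ring

theorem le_expSel_card_inter {c : ℝ} (hc : ∀ v, c ≤ expSel N p q v (selProb N p q v))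
    (T : Finset ℕ) (m : ℕ) :
    (T ∩ Finset.range m).card * c ≤ expSel N p q m (fun S => ((T ∩ S).card : ℝ)) := by
  induction m with
  | zero => simp [expSel]
  | succ m ih =>
    by_cases h : m ∈ T
    · rw [expSel_succ_card_inter_of_mem h (fun x => x), card_inter_range_succ_of_mem h]
      have : expSel N p q m (fun S => selProb N p q m S * (((T ∩ S).card : ℝ) + 1) +
          (1 - selProb N p q m S) * ((T ∩ S).card : ℝ)) =
          expSel N p q m (fun S => ((T ∩ S).card : ℝ) + selProb N p q m S) := by
        congr 1; ext S; ring
      rw [this, expSel_add]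
      push_cast
      linarith [hc m]
    · rw [expSel_succ_card_inter_of_notMem h (fun x => x), card_inter_range_succ_of_notMem h]
      exact ih

theorem expSel_card_inter_le (hp : 0 ≤ p) (hq : 0 ≤ q) (hq' : q ≤ 1 / 2)
    (hN : ∀ v, ∀ u ∈ N v, u < v) (T : Finset ℕ) (m : ℕ) :
    expSel N p q m (fun S => ((T ∩ S).card : ℝ)) ≤ (T ∩ Finset.range m).card * q := by
  induction m with
  | zero => simp [expSel]
  | succ m ih =>
    by_cases h : m ∈ T
    · rw [expSel_succ_card_inter_of_mem h (fun x => x), card_inter_range_succ_of_mem h]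
      have : expSel N p q m (fun S => selProb N p q m S * (((T ∩ S).card : ℝ) + 1) +
          (1 - selProb N p q m S) * ((T ∩ S).card : ℝ)) ≤
          expSel N p q m (fun S => ((T ∩ S).card : ℝ) + q) := by
        refine expSel_mono hp hq hq' hN fun S _ _ => ?_
        linarith [selProb_le (N := N) (p := p) hq m S]
      refine this.trans ?_
      rw [expSel_add, expSel_const]
      push_cast
      linarith
    · rw [expSel_succ_card_inter_of_notMem h (fun x => x), card_inter_range_succ_of_notMem h]
      exact ih

/-- Each member of `T` enters with conditional probability at most `q`, so the second moment is
controlled as for a binomial variable. -/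
theorem expSel_card_inter_sq_le (hp : 0 ≤ p) (hq : 0 ≤ q) (hq' : q ≤ 1 / 2)
    (hN : ∀ v, ∀ u ∈ N v, u < v) (T : Finset ℕ) (m : ℕ) :
    expSel N p q m (fun S => ((T ∩ S).card : ℝ) ^ 2) ≤
      ((T ∩ Finset.range m).card * q) ^ 2 + (T ∩ Finset.range m).card * q := by
  induction m with
  | zero => simp [expSel]
  | succ m ih =>
    by_cases h : m ∈ T
    · rw [expSel_succ_card_inter_of_mem h (fun x => x ^ 2), card_inter_range_succ_of_mem h]
      have : expSel N p q m (fun S => selProb N p q m S * (((T ∩ S).card : ℝ) + 1) ^ 2 +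
          (1 - selProb N p q m S) * ((T ∩ S).card : ℝ) ^ 2) ≤
          expSel N p q m (fun S => ((T ∩ S).card : ℝ) ^ 2 + (2 * q * ((T ∩ S).card : ℝ) + q)) := by
        refine expSel_mono hp hq hq' hN fun S _ _ => ?_
        have h1 := selProb_le (N := N) (p := p) hq m S
        have h2 : (0 : ℝ) ≤ 2 * ((T ∩ S).card : ℝ) + 1 := by positivity
        nlinarith [mul_le_mul_of_nonneg_right h1 h2]
      refine this.trans ?_
      rw [expSel_add, expSel_add, expSel_const, expSel_mul]
      have h3 := expSel_card_inter_le hp hq hq' hN T m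
      have h4 := mul_le_mul_of_nonneg_left h3 (by positivity : 0 ≤ 2 * q)
      push_cast
      nlinarith [sq_nonneg q]
    · rw [expSel_succ_card_inter_of_notMem h (fun x => x ^ 2), card_inter_range_succ_of_notMem h]
      exact ih

theorem exp_neg_le_quadratic {x : ℝ} (hx : 0 ≤ x) : Real.exp (-x) ≤ 1 - x + x ^ 2 := by
  by_cases h1 : x ≤ 1
  · have := Real.abs_exp_sub_one_sub_id_le (x := -x) (by rwa [abs_neg, abs_of_nonneg hx])
    have := (abs_le.1 this).2
    nlinarith
  · have : Real.exp (-x) ≤ 1 := Real.exp_le_one_iff.2 (by linarith)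
    nlinarith

/-- The quadratic bound on `exp` turns a mean of at least 3 into `1 - 3 * lam` plus a second-moment
term, which `hlamM` keeps below `lam`. -/
theorem expSel_exp_neg_card_inter_le (hp : 0 ≤ p) (hq : 0 ≤ q) (hq' : q ≤ 1 / 2)
    (hN : ∀ v, ∀ u ∈ N v, u < v) {c : ℝ} (hc : ∀ v, c ≤ expSel N p q v (selProb N p q v))
    {T : Finset ℕ} {n : ℕ} (hT : T ⊆ Finset.range n) (hTc : 3 ≤ T.card * c)
    {M lam : ℝ} (hTq : T.card * q ≤ M) (hlam : 0 ≤ lam) (hlamM : lam * (M ^ 2 + M) ≤ 1) :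
    expSel N p q n (fun S => Real.exp (-(lam * (T ∩ S).card))) ≤ Real.exp (-(2 * lam)) := by
  have h1 := le_expSel_card_inter hc T n
  have h2 := expSel_card_inter_sq_le hp hq hq' hN T n
  rw [Finset.inter_eq_left.2 hT] at h1 h2
  have h0 : 0 ≤ T.card * q := by positivity
  have h3 : expSel N p q n (fun S => ((T ∩ S).card : ℝ) ^ 2) ≤ M ^ 2 + M := by nlinarith
  calc expSel N p q n (fun S => Real.exp (-(lam * (T ∩ S).card)))
      ≤ expSel N p q n (fun S => 1 + ((-lam) * ((T ∩ S).card : ℝ) +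
          lam ^ 2 * ((T ∩ S).card : ℝ) ^ 2)) := by
        refine expSel_mono hp hq hq' hN fun S _ _ => ?_
        have := exp_neg_le_quadratic (x := lam * (T ∩ S).card) (by positivity)
        nlinarith
    _ ≤ -(2 * lam) + 1 := by
        rw [expSel_add, expSel_add, expSel_const, expSel_mul, expSel_mul]
        nlinarith [mul_le_mul_of_nonneg_left h3 (sq_nonneg lam),
          mul_le_mul_of_nonneg_left hlamM hlam,
          mul_le_mul_of_nonneg_left (hTc.trans h1) hlam]
    _ ≤ Real.exp (-(2 * lam)) := Real.add_one_le_exp _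

end Selection

/-! ### Colouring by repeated random sets and a greedy finish -/

theorem exists_greedy_coloring {back : ℕ → Finset ℕ} {h n : ℕ} (hlt : ∀ v, ∀ u ∈ back v, u < v)
    (hcard : ∀ v < n, (back v).card < h) :
    ∃ col : ℕ → ℕ, ∀ v < n, col v < h ∧ ∀ u ∈ back v, col u ≠ col v := by
  induction n with
  | zero => exact ⟨id, by simp⟩
  | succ n ih =>
    obtain ⟨col, hcol⟩ := ih fun v hv => hcard v (hv.trans n.lt_succ_self)
    obtain ⟨a, ha, ha'⟩ : ∃ a ∈ Finset.range h, a ∉ (back n).image col := by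
      refine Finset.exists_mem_notMem_of_card_lt_card ?_
      rw [Finset.card_range]
      exact Finset.card_image_le.trans_lt (hcard n n.lt_succ_self)
    refine ⟨Function.update col n a, fun v hv => ?_⟩
    rcases Nat.lt_succ_iff_lt_or_eq.1 hv with hv | rfl
    · rw [Function.update_of_ne hv.ne]
      refine ⟨(hcol v hv).1, fun u hu => ?_⟩
      rw [Function.update_of_ne ((hlt v u hu).trans hv).ne]
      exact (hcol v hv).2 u hu
    · rw [Function.update_self]
      refine ⟨Finset.mem_range.1 ha, fun u hu => ?_⟩
      rw [Function.update_of_ne (hlt v u hu).ne]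
      exact fun e => ha' (Finset.mem_image.2 ⟨u, hu, e⟩)

section Coloring

variable {N : ℕ → Finset ℕ} {p q : ℝ}

theorem exists_le_expSel (hp : 0 ≤ p) (hq : 0 ≤ q) (hq' : q ≤ 1 / 2) (hN : ∀ v, ∀ u ∈ N v, u < v)
    (n : ℕ) (f : Finset ℕ → ℝ) :
    ∃ S ⊆ Finset.range n, (∀ v ∈ S, ∀ u ∈ S, u ∉ N v) ∧ f S ≤ expSel N p q n f := by
  classical
  obtain ⟨S, hS, hmin⟩ := Finset.exists_min_image
    ((Finset.range n).powerset.filter fun S => ∀ v ∈ S, ∀ u ∈ S, u ∉ N v) f ⟨∅, by simp⟩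
  simp only [Finset.mem_filter, Finset.mem_powerset] at hS hmin
  refine ⟨S, hS.1, hS.2, ?_⟩
  rw [← expSel_const (N := N) (p := p) (q := q) n (f S)]
  exact expSel_mono hp hq hq' hN fun S' h1 h2 => hmin S' ⟨h1, h2⟩

/-- The potential of a set `R` of uncoloured vertices: it controls the vertices with at least `h`
uncoloured neighbours preceding them. -/
noncomputable def uncoloredPotential (N : ℕ → Finset ℕ) (lam : ℝ) (h n : ℕ) (R : Finset ℕ) : ℝ :=
  ∑ v ∈ Finset.range n, if h ≤ (N v ∩ R).card then Real.exp (lam * (N v ∩ R).card) else 0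

theorem exists_uncoloredPotential_sdiff_le (hp : 0 ≤ p) (hq : 0 ≤ q) (hq' : q ≤ 1 / 2)
    (hN : ∀ v, ∀ u ∈ N v, u < v) {lam : ℝ} {h n : ℕ}
    (hT : ∀ v < n, ∀ T ⊆ N v, h ≤ T.card →
      expSel N p q n (fun S => Real.exp (-(lam * (T ∩ S).card))) ≤ Real.exp (-(2 * lam)))
    (R : Finset ℕ) :
    ∃ S ⊆ Finset.range n, (∀ v ∈ S, ∀ u ∈ S, u ∉ N v) ∧
      uncoloredPotential N lam h n (R \ S) ≤
        Real.exp (-(2 * lam)) * uncoloredPotential N lam h n R := by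
  obtain ⟨S, hS, hind, hle⟩ := exists_le_expSel hp hq hq' hN n
    fun S => uncoloredPotential N lam h n (R \ S)
  refine ⟨S, hS, hind, hle.trans ?_⟩
  unfold uncoloredPotential
  rw [expSel_sum, Finset.mul_sum]
  refine Finset.sum_le_sum fun v hv => ?_
  have hsub : ∀ S : Finset ℕ, N v ∩ (R \ S) = (N v ∩ R) \ S := fun S => by
    ext; simp only [Finset.mem_inter, Finset.mem_sdiff]; tauto
  by_cases hvR : h ≤ (N v ∩ R).card
  · rw [if_pos hvR]
    refine le_trans (expSel_mono (g := fun S => Real.exp (lam * (N v ∩ R).card) *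
      Real.exp (-(lam * ((N v ∩ R) ∩ S).card))) hp hq hq' hN fun S _ _ => ?_) ?_
    · split_ifs
      · rw [← Real.exp_add]
        refine le_of_eq ?_
        congr 1
        have : ((N v ∩ R ∩ S).card : ℝ) + (N v ∩ (R \ S)).card = (N v ∩ R).card := by
          rw [hsub]
          exact_mod_cast Finset.card_inter_add_card_sdiff (N v ∩ R) S
        rw [← this]
        ring
      · positivity
    · rw [expSel_mul, mul_comm]
      exact mul_le_mul_of_nonneg_right
        (hT v (Finset.mem_range.1 hv) _ Finset.inter_subset_left hvR) (Real.exp_pos _).le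
  · rw [if_neg hvR, mul_zero]
    refine le_of_eq ((expSel_congr fun S _ => ?_).trans (expSel_const n 0))
    -- Deleting vertices never lifts a neighbourhood back above the threshold `h`.
    refine if_neg fun hle => hvR (hle.trans ?_)
    rw [hsub]
    exact Finset.card_le_card Finset.sdiff_subset

/-- `R` is the set of vertices still uncoloured after `j` rounds; each round gives colour `j` to the
members of `R` in a new independent set. -/
theorem exists_partial_coloring (hp : 0 ≤ p) (hq : 0 ≤ q) (hq' : q ≤ 1 / 2)
    (hN : ∀ v, ∀ u ∈ N v, u < v) {lam : ℝ} (hlam : 0 ≤ lam) {h n d : ℕ}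
    (hd : ∀ v, (N v).card ≤ d)
    (hT : ∀ v < n, ∀ T ⊆ N v, h ≤ T.card →
      expSel N p q n (fun S => Real.exp (-(lam * (T ∩ S).card))) ≤ Real.exp (-(2 * lam)))
    (j : ℕ) :
    ∃ (R : Finset ℕ) (col : ℕ → ℕ), (∀ v < n, v ∉ R → col v < j) ∧
      (∀ v < n, v ∉ R → ∀ u ∈ N v, u ∉ R → col u ≠ col v) ∧
      uncoloredPotential N lam h n R ≤ Real.exp (-(2 * lam) * j) * (n * Real.exp (lam * d)) := by
  induction j with
  | zero =>
    refine ⟨Finset.range n, id, by simp, fun v hv hv' => absurd (Finset.mem_range.2 hv) hv', ?_⟩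
    have : uncoloredPotential N lam h n (Finset.range n) ≤
        ∑ v ∈ Finset.range n, Real.exp (lam * d) := by
      refine Finset.sum_le_sum fun v _ => ?_
      split_ifs
      · refine Real.exp_le_exp.2 (mul_le_mul_of_nonneg_left ?_ hlam)
        exact_mod_cast (Finset.card_le_card Finset.inter_subset_left).trans (hd v)
      · positivity
    simpa using this
  | succ j ih =>
    obtain ⟨R, col, h1, h2, h3⟩ := ih
    obtain ⟨S, -, hind, hS⟩ := exists_uncoloredPotential_sdiff_le hp hq hq' hN hT R
    refine ⟨R \ S, fun v => if v ∈ R then j else col v, fun v hv hvR => ?_,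
      fun v hv hvR u hu huR => ?_, hS.trans ?_⟩
    · dsimp only
      split_ifs with hR
      · exact j.lt_succ_self
      · exact (h1 v hv hR).trans j.lt_succ_self
    · dsimp only
      simp only [Finset.mem_sdiff, not_and, not_not] at hvR huR
      have hun := (hN v u hu).trans hv
      split_ifs with hu' hv' hv'
      · exact absurd hu (hind v (hvR hv') u (huR hu'))
      · exact (h1 v hv hv').ne'
      · exact (h1 u hun hu').ne
      · exact h2 v hv hv' u hu hu'
    · refine (mul_le_mul_of_nonneg_left h3 (Real.exp_pos _).le).trans (le_of_eq ?_)
      rw [← mul_assoc, ← Real.exp_add]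
      push_cast
      ring_nf

theorem exists_coloring_of_expSel (hp : 0 ≤ p) (hq : 0 ≤ q) (hq' : q ≤ 1 / 2)
    (hN : ∀ v, ∀ u ∈ N v, u < v) {lam : ℝ} (hlam : 0 ≤ lam) {h k n : ℕ}
    (hd : ∀ v, (N v).card ≤ k + h)
    (hT : ∀ v < n, ∀ T ⊆ N v, h ≤ T.card →
      expSel N p q n (fun S => Real.exp (-(lam * (T ∩ S).card))) ≤ Real.exp (-(2 * lam)))
    (hn : (n : ℝ) < Real.exp (lam * k)) :
    ∃ col : ℕ → ℕ, ∀ v < n, col v < k + h ∧ ∀ u ∈ N v, col u ≠ col v := by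
  obtain ⟨R, col, h1, h2, h3⟩ := exists_partial_coloring hp hq hq' hN hlam hd hT k
  have hR : ∀ v < n, (N v ∩ R).card < h := by
    intro v hv
    by_contra! hvR
    -- A single vertex with `h` uncoloured preceding neighbours already contributes `exp (lam * h)`,
    -- more than the whole potential after `k` rounds.
    have h4 : Real.exp (lam * h) ≤ uncoloredPotential N lam h n R := by
      refine le_trans ?_ (Finset.single_le_sum (f := fun v =>
        if h ≤ (N v ∩ R).card then Real.exp (lam * (N v ∩ R).card) else 0)
        (fun v _ => by split_ifs <;> positivity) (Finset.mem_range.2 hv))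
      rw [if_pos hvR]
      exact Real.exp_le_exp.2 (mul_le_mul_of_nonneg_left (by exact_mod_cast hvR) hlam)
    have h5 : Real.exp (-(2 * lam) * k) * (n * Real.exp (lam * (k + h : ℕ))) <
        Real.exp (-(2 * lam) * k) * (Real.exp (lam * k) * Real.exp (lam * (k + h : ℕ))) := by
      gcongr
    rw [← Real.exp_add, ← Real.exp_add] at h5
    have h6 : -(2 * lam) * k + (lam * k + lam * (k + h : ℕ)) = lam * h := by push_cast; ring
    rw [h6] at h5
    linarith
  obtain ⟨col', hcol'⟩ := exists_greedy_coloring (back := fun v => N v ∩ R)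
    (fun v u hu => hN v u (Finset.mem_inter.1 hu).1) hR
  -- The greedy phase uses the fresh colours `k, …, k + h - 1`.
  refine ⟨fun v => if v ∈ R then k + col' v else col v, fun v hv => ⟨?_, fun u hu => ?_⟩⟩
  · dsimp only
    split_ifs with hvR
    · have := (hcol' v hv).1
      omega
    · have := h1 v hv hvR
      omega
  · have hun := (hN v u hu).trans hv
    dsimp only
    split_ifs with huR hvR hvR
    · have := (hcol' v hv).2 u (Finset.mem_inter.2 ⟨hu, huR⟩)
      omega
    · have := h1 v hv hvR
      omega
    · have := h1 u hun huR
      omega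
    · exact h2 v hv hvR u hu huR

end Coloring

theorem exists_coloring_of_card_lt_exp :
    ∃ lam : ℝ, 0 < lam ∧ ∃ D : ℕ, ∀ d ≥ D, ∀ (N : ℕ → Finset ℕ) (n : ℕ),
      (∀ v, ∀ u ∈ N v, u < v) → (∀ v, ∀ u ∈ N v, ∀ w ∈ N v, w ∉ N u) →
      (∀ v, (N v).card ≤ d) → (n : ℝ) < Real.exp (lam * (d / 2 : ℕ)) →
      ∃ col : ℕ → ℕ, ∀ v < n, col v < d ∧ ∀ u ∈ N v, col u ≠ col v := by
  set M : ℝ := 12 * Real.exp 48 with hM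
  have hM0 : 0 < M := by positivity
  -- With `p = 12 / d` and `L = 48` the selection probability is at least `12 / d - 6 / d = 6 / d`,
  -- giving mean at least 3 on sets of size at least `d / 2`. The cap is `q = p * exp L = M / d`,
  -- and `d ≥ 2 * M` makes it at most `1 / 2`.
  refine ⟨1 / (M ^ 2 + M), by positivity, ⌈2 * M⌉₊ + 1, fun d hdD N n hN htri hd hn => ?_⟩
  have hdM : 2 * M ≤ d := (Nat.le_ceil _).trans (by exact_mod_cast (Nat.le_succ _).trans hdD)
  have hd0 : (0 : ℝ) < d := by linarith
  have hp : (0 : ℝ) < 12 / d := by positivity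
  have hq : 0 ≤ M / d := by positivity
  have hq' : M / d ≤ 1 / 2 := by rw [div_le_div_iff₀ hd0 two_pos]; linarith
  have hc : ∀ v, 6 / d ≤ expSel N (12 / d) (M / d) v (selProb N (12 / d) (M / d) v) := by
    intro v
    refine le_trans (le_of_eq ?_) (le_expSel_selProb hp hq hq' hN htri (L := 48) (by norm_num)
      (le_of_eq ?_) hd v)
    · field_simp
      norm_num
    · rw [hM]; ring
  have hkh : d / 2 + (d - d / 2) = d := by omega
  have := exists_coloring_of_expSel (k := d / 2) (h := d - d / 2) hp.le hq hq' hN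
    (lam := 1 / (M ^ 2 + M)) (by positivity) (by rwa [hkh]) (fun v hv T hTv hTc => ?_) hn
  · rwa [hkh] at this
  · refine expSel_exp_neg_card_inter_le hp.le hq hq' hN hc (M := M) (fun u hu => ?_) ?_ ?_
      (by positivity) (le_of_eq ?_)
    · exact Finset.mem_range.2 ((hN v u (hTv hu)).trans hv)
    · have h1 : d ≤ 2 * T.card := by omega
      have h2 : (d : ℝ) ≤ 2 * T.card := by exact_mod_cast h1
      rw [← mul_div_assoc, le_div_iff₀ hd0]
      linarith
    · have h1 : (T.card : ℝ) ≤ d := by exact_mod_cast (Finset.card_le_card hTv).trans (hd v)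
      rw [← mul_div_assoc, div_le_iff₀ hd0, mul_comm]
      exact mul_le_mul_of_nonneg_left h1 hM0.le
    · field_simp

/-! ### The block construction for the upper bound -/

/-- The vertices of the tree-like graph: a level `k`, a table whose row `j` lists the neighbours of the
block of level `j`, and a position inside the block. -/
abbrev BlockVertex (d m : ℕ) : Type :=
  Fin (d + 1) × (Fin (d + 1) → Fin (d + 1) → Fin m) × Fin m

namespace BlockVertex

variable {d m : ℕ} [NeZero m]

/-- Erase the rows of the table beyond level `i`. -/
def trunc (i : Fin (d + 1)) (t : Fin (d + 1) → Fin (d + 1) → Fin m) :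
    Fin (d + 1) → Fin (d + 1) → Fin m :=
  fun j l => if j ≤ i then t j l else 0

/-- The neighbour of `v` in the ancestor block of level `i`. -/
def parent (v : BlockVertex d m) (i : Fin (d + 1)) : BlockVertex d m :=
  (i, trunc i v.2.1, v.2.1 v.1 i)

/-- The vertex `v` is to be joined to its parents: they are pairwise nonadjacent. -/
def Admissible (v : BlockVertex d m) : Prop :=
  ∀ i j, i < j → j < v.1 → v.2.1 v.1 i ≠ v.2.1 j i

/-- The relation `u` is a parent of the admissible vertex `v`. -/
def IsParent (u v : BlockVertex d m) : Prop :=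
  u.1 < v.1 ∧ v.Admissible ∧ u = v.parent u.1

/-- Admissible vertices are joined to their parents. -/
def graph (d m : ℕ) [NeZero m] : SimpleGraph (BlockVertex d m) where
  Adj u v := IsParent u v ∨ IsParent v u
  symm := ⟨fun _ _ h => h.symm⟩
  loopless := ⟨fun _ h => h.elim (fun h => lt_irrefl _ h.1) fun h => lt_irrefl _ h.1⟩

theorem IsParent.of_adj {u v : BlockVertex d m} (h : (graph d m).Adj u v) (huv : u.1 ≤ v.1) :
    IsParent u v :=
  h.resolve_right fun h' => absurd h'.1 huv.not_gt

/-- The table of a parent `v` agrees with that of `w` up to the level of `v`, so an edge from `u` to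
`v` would make two rows of the table of `w` agree in the column of `u`, against admissibility. -/
theorem not_adj_of_isParent {u v w : BlockVertex d m} (hu : IsParent u w) (hv : IsParent v w) :
    ¬ IsParent u v := by
  intro huv
  have h1 : u = w.parent u.1 := hu.2.2
  have h2 : v = w.parent v.1 := hv.2.2
  have h3 : u = v.parent u.1 := huv.2.2
  have e1 : u.2.2 = w.2.1 w.1 u.1 := congrArg (fun x => x.2.2) h1
  have e3 : u.2.2 = v.2.1 v.1 u.1 := congrArg (fun x => x.2.2) h3
  have e2 : v.2.1 = trunc v.1 w.2.1 := congrArg (fun x => x.2.1) h2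
  refine hu.2.1 u.1 v.1 huv.1 hv.1 ?_
  rw [← e1, e3, e2]
  simp [trunc]

theorem cliqueFree_graph : (graph d m).CliqueFree 3 := by
  intro s hs
  obtain ⟨a, b, c, hab, hac, hbc, -⟩ := SimpleGraph.is3Clique_iff.1 hs
  have key : ∀ a b c : BlockVertex d m, (graph d m).Adj a b → (graph d m).Adj a c →
      (graph d m).Adj b c → a.1 ≤ b.1 → b.1 ≤ c.1 → False := fun a b c hab hac hbc h1 h2 =>
    not_adj_of_isParent (.of_adj hac (h1.trans h2)) (.of_adj hbc h2) (.of_adj hab h1)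
  rcases le_total a.1 b.1 with h1 | h1 <;> rcases le_total a.1 c.1 with h2 | h2 <;>
    rcases le_total b.1 c.1 with h3 | h3
  · exact key a b c hab hac hbc h1 h3
  · exact key a c b hac hab hbc.symm h2 h3
  · exact key a b c hab hac hbc h1 h3
  · exact key c a b hac.symm hbc.symm hab h2 h1
  · exact key b a c hab.symm hbc hac h1 h2
  · exact key b a c hab.symm hbc hac h1 h2
  · exact key b c a hbc hab.symm hac.symm h3 h2
  · exact key c b a hbc.symm hac.symm hab.symm h3 h1

theorem ncard_isParent_le (v : BlockVertex d m) : {u | IsParent u v}.ncard ≤ d := by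
  have hsub : {u | IsParent u v} ⊆ ((Finset.Iio v.1).image v.parent : Finset (BlockVertex d m)) := by
    intro u hu
    rw [Finset.mem_coe, Finset.mem_image]
    exact ⟨u.1, Finset.mem_Iio.2 hu.1, hu.2.2.symm⟩
  refine (Set.ncard_le_ncard hsub (Finset.finite_toSet _)).trans ?_
  rw [Set.ncard_coe_finset]
  refine Finset.card_image_le.trans ?_
  rw [Fin.card_Iio]
  exact Nat.le_of_lt_succ v.1.2

theorem trunc_trunc {i j : Fin (d + 1)} (hij : i ≤ j) (t : Fin (d + 1) → Fin (d + 1) → Fin m) :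
    trunc i (trunc j t) = trunc i t := by
  ext a l
  unfold trunc
  by_cases h : a ≤ i
  · simp [h, h.trans hij]
  · simp [h]

theorem trunc_update_of_lt {i j : Fin (d + 1)} (hij : i < j)
    (t : Fin (d + 1) → Fin (d + 1) → Fin m) (x : Fin (d + 1) → Fin m) :
    trunc i (Function.update t j x) = trunc i t := by
  ext a l
  unfold trunc
  by_cases h : a ≤ i
  · simp [h, Function.update_of_ne (h.trans_lt hij).ne]
  · simp [h]

/-- The table is built row by row. The new row picks in each earlier block a vertex of its popular
colour `c i`. All vertices of the new block are joined to these picks, so its own popular colour is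
new. -/
theorem exists_distinct_block_colors (hm : d * d ≤ m) (col : (graph d m).Coloring (Fin d))
    (k : ℕ) (hk : k ≤ d) :
    ∃ (t : Fin (d + 1) → Fin (d + 1) → Fin m) (c : Fin (d + 1) → Fin d),
      ∀ i : Fin (d + 1), (i : ℕ) ≤ k →
        d ≤ (Finset.univ.filter fun x => col (i, trunc i t, x) = c i).card ∧
        ∀ j < i, c j ≠ c i := by
  have : Nonempty (Fin d) := ⟨col (0, fun _ _ => 0, 0)⟩
  have pigeon : ∀ (i : Fin (d + 1)) t, ∃ a : Fin d,
      d ≤ (Finset.univ.filter fun x : Fin m => col (i, t, x) = a).card := fun i t =>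
    Fintype.exists_le_card_fiber_of_mul_le_card (fun x : Fin m => col (i, t, x)) (by simpa using hm)
  induction k with
  | zero =>
    obtain ⟨a, ha⟩ := pigeon 0 (trunc 0 fun _ _ => 0)
    refine ⟨fun _ _ => 0, fun _ => a, fun i hi => ?_⟩
    obtain rfl : i = 0 := Fin.ext (by simpa using hi)
    exact ⟨ha, fun j hj => absurd hj (Fin.not_lt_zero j)⟩
  | succ k ih =>
    obtain ⟨t, c, h⟩ := ih (Nat.le_of_succ_le hk)
    let κ : Fin (d + 1) := ⟨k, by omega⟩
    let κ' : Fin (d + 1) := ⟨k + 1, by omega⟩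
    have hlt : ∀ i : Fin (d + 1), i < κ' ↔ (i : ℕ) ≤ k := fun i => by
      rw [Fin.lt_def]; exact Nat.lt_succ_iff
    have hx : ∀ i : Fin (d + 1), ∃ x : Fin m, i < κ' →
        col (i, trunc i t, x) = c i ∧ ∀ j, i < j → j < κ' → x ≠ t j i := by
      intro i
      by_cases hi : i < κ'
      · obtain ⟨x, hx1, hx2⟩ : ∃ x ∈ Finset.univ.filter fun x => col (i, trunc i t, x) = c i,
            x ∉ (Finset.Ioc i κ).image fun j => t j i := by
          -- At least `d` positions carry the colour `c i`, while admissibility forbids at most `k <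
          -- d` of them.
          refine Finset.exists_mem_notMem_of_card_lt_card
            (Finset.card_image_le.trans_lt (lt_of_lt_of_le ?_ (h i ((hlt i).1 hi)).1))
          rw [Fin.card_Ioc]
          exact (Nat.sub_le _ _).trans_lt hk
        refine ⟨x, fun _ => ⟨(Finset.mem_filter.1 hx1).2, fun j hij hj e => hx2 ?_⟩⟩
        exact Finset.mem_image.2 ⟨j, Finset.mem_Ioc.2 ⟨hij, (hlt j).1 hj⟩, e.symm⟩
      -- A row is read only at lower levels; 0 is a filler elsewhere.
      · exact ⟨0, fun hi' => absurd hi' hi⟩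
    choose x hx using hx
    let t' := Function.update t κ' x
    obtain ⟨a, ha⟩ := pigeon κ' (trunc κ' t')
    have hrow : trunc κ' t' κ' = x := by
      ext l
      simp [trunc, t']
    have hadm : ∀ y : Fin m, Admissible (κ', trunc κ' t', y) := by
      intro y i j hij hj
      have hj' : j < κ' := hj
      change trunc κ' t' κ' i ≠ trunc κ' t' j i
      rw [hrow]
      have : trunc κ' t' j i = t j i := by
        simp [trunc, t', hj'.le, Function.update_of_ne hj'.ne]
      rw [this]
      exact (hx i (hij.trans hj')).2 j hij hj'
    have hpar : ∀ (y : Fin m) (i), i < κ' →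
        parent (κ', trunc κ' t', y) i = (i, trunc i t, x i) := by
      intro y i hi
      change (i, trunc i (trunc κ' t'), trunc κ' t' κ' i) = _
      rw [hrow, trunc_trunc hi.le, trunc_update_of_lt hi]
    have hne : ∀ i < κ', c i ≠ a := by
      intro i hi e
      obtain ⟨y, hy⟩ : (Finset.univ.filter fun y => col (κ', trunc κ' t', y) = a).Nonempty :=
        Finset.card_pos.1 (by omega)
      have hadj : (graph d m).Adj (i, trunc i t, x i) (κ', trunc κ' t', y) :=
        Or.inl ⟨hi, hadm y, (hpar y i hi).symm⟩
      exact col.valid hadj (((hx i hi).1.trans e).trans (Finset.mem_filter.1 hy).2.symm)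
    refine ⟨t', Function.update c κ' a, fun i hi => ?_⟩
    rcases eq_or_ne i κ' with rfl | hi'
    · rw [Function.update_self]
      exact ⟨ha, fun j hj => by rw [Function.update_of_ne hj.ne]; exact hne j hj⟩
    · have hi2 : i < κ' := lt_of_le_of_ne hi hi'
      rw [Function.update_of_ne hi', trunc_update_of_lt hi2]
      refine ⟨(h i ((hlt i).1 hi2)).1, fun j hj => ?_⟩
      rw [Function.update_of_ne (hj.trans hi2).ne]
      exact (h i ((hlt i).1 hi2)).2 j hj

theorem not_colorable_graph (hm : d * d ≤ m) : ¬ (graph d m).Colorable d := by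
  rintro ⟨col⟩
  obtain ⟨t, c, h⟩ := exists_distinct_block_colors hm col d le_rfl
  have hinj : Function.Injective c := by
    intro i j hij
    rcases lt_trichotomy i j with hlt | rfl | hlt
    · exact absurd hij ((h j (Nat.le_of_lt_succ j.2)).2 i hlt)
    · rfl
    · exact absurd hij.symm ((h i (Nat.le_of_lt_succ i.2)).2 j hlt)
  have := Fintype.card_le_of_injective c hinj
  simp at this

theorem isDegenerate_graph : (graph d m).IsDegenerate d := by
  -- Vertices are ordered by level, with arbitrary ties inside a level; levels have no internal
  -- edges.
  refine ⟨LinearOrder.lift' (fun v : BlockVertex d m => toLex (v.1, Fintype.equivFin _ v))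
    fun u v h => ?_, fun v => ?_⟩
  · exact (Fintype.equivFin _).injective (congrArg (fun x => (ofLex x).2) h)
  · refine (Set.ncard_le_ncard ?_ (Set.toFinite _)).trans (ncard_isParent_le v)
    rintro u ⟨hadj, hlt⟩
    refine .of_adj hadj ?_
    rcases (Prod.Lex.lt_iff).1 hlt with h | h
    · exact h.le
    · exact h.1.le

end BlockVertex

/-! ### Transfer to graphs and the final bounds -/

/-- Relabels the vertices by their rank, so that the selection process can run on natural numbers.
-/
theorem exists_precedingNeighbors {V : Type*} [Fintype V] {G : SimpleGraph V} {d : ℕ}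
    (hG : G.IsDegenerate d) :
    ∃ (N : ℕ → Finset ℕ) (r : V → ℕ), Function.Injective r ∧ (∀ a, r a < Fintype.card V) ∧
      (∀ v, ∀ u ∈ N v, u < v) ∧ (∀ v, (N v).card ≤ d) ∧
      (∀ v, ∀ u ∈ N v, ∃ a b, r a = u ∧ r b = v ∧ G.Adj a b) ∧
      ∀ a b, G.Adj a b → r a < r b → r a ∈ N (r b) := by
  classical
  obtain ⟨_, h⟩ := hG
  let e : Fin (Fintype.card V) ≃o V := Fintype.orderIsoFinOfCardEq V rfl
  have hr : ∀ a b : V, (e.symm a : ℕ) < e.symm b ↔ a < b := fun a b => by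
    rw [← Fin.lt_def, OrderIso.lt_iff_lt]
  have hinj : Function.Injective fun a => (e.symm a : ℕ) :=
    Fin.val_injective.comp e.symm.injective
  refine ⟨fun v => if hv : v < Fintype.card V then (Finset.univ.filter fun u =>
    G.Adj u (e ⟨v, hv⟩) ∧ u < e ⟨v, hv⟩).image fun u => (e.symm u : ℕ) else ∅,
    fun a => (e.symm a : ℕ), hinj, fun a => (e.symm a).2, fun v u hu => ?_, fun v => ?_,
    fun v u hu => ?_, fun a b hab hlt => ?_⟩
  · dsimp only at hu
    split_ifs at hu with hv
    · obtain ⟨a, ha, rfl⟩ := Finset.mem_image.1 hu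
      simpa using (hr a (e ⟨v, hv⟩)).2 (Finset.mem_filter.1 ha).2.2
    · simp at hu
  · dsimp only
    split_ifs with hv
    · refine Finset.card_image_le.trans ?_
      have := h (e ⟨v, hv⟩)
      rwa [← Set.ncard_coe_finset, Finset.coe_filter_univ]
    · simp
  · dsimp only at hu
    split_ifs at hu with hv
    · obtain ⟨a, ha, rfl⟩ := Finset.mem_image.1 hu
      exact ⟨a, e ⟨v, hv⟩, rfl, by simp, (Finset.mem_filter.1 ha).2.1⟩
    · simp at hu
  · dsimp only
    rw [dif_pos (e.symm b).2]
    refine Finset.mem_image.2 ⟨a, Finset.mem_filter.2 ⟨Finset.mem_univ _, ?_⟩, rfl⟩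
    simpa using ⟨hab, (hr a b).1 hlt⟩

theorem colorable_of_coloring_nat {V : Type*} {G : SimpleGraph V} {N : ℕ → Finset ℕ} {r : V → ℕ}
    {n d : ℕ} (hr : Function.Injective r) (hrn : ∀ a, r a < n)
    (hadj : ∀ a b, G.Adj a b → r a < r b → r a ∈ N (r b))
    {col : ℕ → ℕ} (hcol : ∀ v < n, col v < d ∧ ∀ u ∈ N v, col u ≠ col v) : G.Colorable d := by
  refine ⟨SimpleGraph.Coloring.mk (fun a => ⟨col (r a), (hcol _ (hrn a)).1⟩) ?_⟩
  intro a b hab heq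
  have heq' : col (r a) = col (r b) := congrArg Fin.val heq
  rcases lt_trichotomy (r a) (r b) with h | h | h
  · exact (hcol _ (hrn b)).2 _ (hadj a b hab h) heq'
  · exact hab.ne (hr h)
  · exact (hcol _ (hrn a)).2 _ (hadj b a hab.symm h) heq'.symm

theorem SimpleGraph.IsDegenerate.colorable {V : Type*} [Fintype V] {G : SimpleGraph V} {d : ℕ}
    (hG : G.IsDegenerate d) : G.Colorable (d + 1) := by
  obtain ⟨N, r, hr, hrn, hN, hd, -, hadj⟩ := exists_precedingNeighbors hG
  obtain ⟨col, hcol⟩ := exists_greedy_coloring (n := Fintype.card V) hN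
    fun v _ => Nat.lt_succ_of_le (hd v)
  exact colorable_of_coloring_nat hr hrn hadj hcol

theorem colorable_of_card_lt_exp :
    ∃ lam : ℝ, 0 < lam ∧ ∃ D : ℕ, ∀ d ≥ D, ∀ {n : ℕ} (G : SimpleGraph (Fin n)),
      G.CliqueFree 3 → G.IsDegenerate d → (n : ℝ) < Real.exp (lam * (d / 2 : ℕ)) →
      G.Colorable d := by
  obtain ⟨lam, hlam, D, h⟩ := exists_coloring_of_card_lt_exp
  refine ⟨lam, hlam, D, fun d hdD n G hfree hG hn => ?_⟩
  obtain ⟨N, r, hr, hrn, hN, hd, hmem, hadj⟩ := exists_precedingNeighbors hG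
  rw [Fintype.card_fin] at hrn
  have htri : ∀ v, ∀ u ∈ N v, ∀ w ∈ N v, w ∉ N u := by
    intro v u hu w hw hwu
    obtain ⟨a, b, rfl, rfl, hab⟩ := hmem v u hu
    obtain ⟨c, b', rfl, hb', hcb⟩ := hmem _ w hw
    obtain ⟨c', a', hc', ha', hca⟩ := hmem _ _ hwu
    obtain rfl := hr hb'
    obtain rfl := hr hc'
    obtain rfl := hr ha'
    exact hfree _ (SimpleGraph.is3Clique_triple_iff.2 ⟨hab, hca.symm, hcb.symm⟩)
  obtain ⟨col, hcol⟩ := h d hdD N n hN htri hd hn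
  exact colorable_of_coloring_nat hr hrn hadj hcol

theorem SimpleGraph.IsDegenerate.of_iso {V W : Type*} [Finite V] [Finite W] {G : SimpleGraph V}
    {H : SimpleGraph W} (e : H ≃g G) {d : ℕ} (hG : G.IsDegenerate d) : H.IsDegenerate d := by
  obtain ⟨_, h⟩ := hG
  refine ⟨LinearOrder.lift' e e.injective, fun v => le_trans ?_ (h (e v))⟩
  refine Set.ncard_le_ncard_of_injOn e (fun u hu => ?_) e.injective.injOn (Set.toFinite _)
  exact ⟨e.map_adj_iff.2 hu.1, hu.2⟩

/-- Block size `d * d + 1` instead of `d * d` keeps blocks nonempty when `d = 0`. -/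
theorem card_blockVertex_mem_criticalOrders (d : ℕ) :
    Fintype.card (BlockVertex d (d * d + 1)) ∈ criticalOrders d := by
  let e : (BlockVertex.graph d (d * d + 1)).map (Fintype.equivFin _).toEmbedding ≃g
    BlockVertex.graph d (d * d + 1) := (SimpleGraph.Iso.map (Fintype.equivFin _) _).symm
  have hdeg := BlockVertex.isDegenerate_graph.of_iso e
  refine ⟨_, ?_, hdeg, ?_⟩
  · exact BlockVertex.cliqueFree_graph.comap e.isContained
  · rw [Nat.cast_add, Nat.cast_one, SimpleGraph.chromaticNumber_eq_iff_colorable_not_colorable]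
    exact ⟨hdeg.colorable, fun hc => BlockVertex.not_colorable_graph (Nat.le_succ (d * d))
      (hc.of_hom e.symm.toHom)⟩

theorem isLeast_minOrder (d : ℕ) : IsLeast (criticalOrders d) (minOrder d) :=
  ⟨Nat.sInf_mem ⟨_, card_blockVertex_mem_criticalOrders d⟩, fun _ h => Nat.sInf_le h⟩

theorem succ_le_of_mem_criticalOrders {d n : ℕ} (h : n ∈ criticalOrders d) : d + 1 ≤ n := by
  obtain ⟨G, -, -, hG⟩ := h
  have := G.chromaticNumber_le_card
  rw [hG, Fintype.card_fin] at this
  exact_mod_cast this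

theorem card_blockVertex_le {d : ℕ} (hd : 2 ≤ d) :
    Fintype.card (BlockVertex d (d * d + 1)) ≤ d ^ (8 * d ^ 2) := by
  have h1 : d * d + 1 ≤ d ^ 3 := by nlinarith [Nat.mul_le_mul hd hd, sq_nonneg d]
  have h2 : d + 1 ≤ d ^ 2 := by nlinarith
  simp only [Fintype.card_prod, Fintype.card_fin, Fintype.card_fun]
  calc (d + 1) * (((d * d + 1) ^ (d + 1)) ^ (d + 1) * (d * d + 1))
      ≤ d ^ 2 * (((d ^ 3) ^ (d + 1)) ^ (d + 1) * d ^ 3) := by gcongr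
    _ = d ^ (2 + (3 * ((d + 1) * (d + 1)) + 3)) := by
        rw [← pow_mul, ← pow_mul, ← pow_add, ← pow_add]
    -- The exponents agree at `d = 2`, where both are 32.
    _ ≤ d ^ (8 * d ^ 2) := Nat.pow_le_pow_right (by omega) (by nlinarith)

theorem exists_exp_le_minOrder :
    ∃ c : ℝ, 0 < c ∧ ∀ d : ℕ, 1 ≤ d → Real.exp (c * d) ≤ (minOrder d : ℝ) := by
  obtain ⟨lam, hlam, D, h⟩ := colorable_of_card_lt_exp
  have hD : (0 : ℝ) < D + 2 := by positivity
  -- `lam / 3` serves large `d`, since `d / 2` rounded down is at least a third of `d` once `d ≥ 2`.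
  -- For `d < D + 2` the trivial bound of 2 vertices suffices, whence `log 2 / (D + 2)`.
  refine ⟨min (lam / 3) (Real.log 2 / (D + 2)),
    lt_min (by positivity) (div_pos (Real.log_pos one_lt_two) hD), fun d hd => ?_⟩
  have hmin := (isLeast_minOrder d).1
  by_cases hdD : D + 2 ≤ d
  · obtain ⟨G, hfree, hdeg, hchi⟩ := hmin
    have hn : Real.exp (lam * (d / 2 : ℕ)) ≤ minOrder d := by
      by_contra! hlt
      have := (h d (by omega) G hfree hdeg hlt).chromaticNumber_le
      rw [hchi] at this
      have : d + 1 ≤ d := by exact_mod_cast this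
      omega
    refine le_trans (Real.exp_le_exp.2 ?_) hn
    have h3 : (d : ℝ) ≤ 3 * (d / 2 : ℕ) := by
      have : d ≤ 3 * (d / 2) := by omega
      exact_mod_cast this
    have h4 := mul_le_mul_of_nonneg_right (min_le_left (lam / 3) (Real.log 2 / (D + 2)))
      (Nat.cast_nonneg (α := ℝ) d)
    have h5 := mul_le_mul_of_nonneg_left h3 hlam.le
    linarith
  · have h2 : (2 : ℝ) ≤ minOrder d := by
      exact_mod_cast (Nat.succ_le_succ hd).trans (succ_le_of_mem_criticalOrders hmin)
    refine le_trans ?_ h2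
    rw [← Real.le_log_iff_exp_le two_pos]
    have hd' : (d : ℝ) ≤ D + 2 := by exact_mod_cast (not_le.1 hdD).le
    calc min (lam / 3) (Real.log 2 / (D + 2)) * d ≤ Real.log 2 / (D + 2) * (D + 2) :=
          mul_le_mul (min_le_right _ _) hd' (Nat.cast_nonneg d)
            (div_nonneg (Real.log_nonneg one_le_two) hD.le)
      _ = Real.log 2 := div_mul_cancel₀ _ hD.ne'

theorem minOrder_le_exp {d : ℕ} (hd : 2 ≤ d) :
    (minOrder d : ℝ) ≤ Real.exp (8 * ((d : ℝ) ^ 2 * Real.log d)) := by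
  have h1 : minOrder d ≤ d ^ (8 * d ^ 2) :=
    ((isLeast_minOrder d).2 (card_blockVertex_mem_criticalOrders d)).trans (card_blockVertex_le hd)
  have hd0 : (0 : ℝ) < d := by positivity
  refine (Nat.cast_le (α := ℝ).2 h1).trans (le_of_eq ?_)
  rw [Nat.cast_pow, ← Real.exp_log (pow_pos hd0 _), Real.log_pow]
  push_cast
  ring_nf

theorem theorem5 :
    (∀ d : ℕ, IsLeast (criticalOrders d) (minOrder d)) ∧
    (∃ c : ℝ, 0 < c ∧ ∀ d : ℕ, 1 ≤ d → Real.exp (c * d) ≤ (minOrder d : ℝ)) ∧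
    (∃ C : ℝ, 0 < C ∧ ∀ d : ℕ, 2 ≤ d →
      (minOrder d : ℝ) ≤ Real.exp (C * ((d : ℝ) ^ 2 * Real.log d))) :=
  ⟨isLeast_minOrder, exists_exp_le_minOrder, 8, by norm_num, fun _ hd => minOrder_le_exp hd⟩
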